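/- Let $p$ be a prime such that $-1$ is not a square in $K=\mathbb{Q}_p$. Write $p+1=2^a l$ with $l$ odd, and let $n=2^\alpha k$ with $k$ odd and $2\le\alpha\le a+1$. Then there is a cyclic Galois extension $L/K$ of degree $n$, which is unramified, such that the following holds for every generator $\sigma$ of $\operatorname{Gal}(L/K)$. For $b\in L$ let $f_{b,\sigma}$ be the alternating $K$-bilinear form on $L$ given by $$f_{b,\sigma}(x,y)=\operatorname{Tr}_{L/K}\bigl(b\,(x\,\sigma(y)-\sigma(x)\,y)\bigr),\qquad x,y\in L,$$ and put $A^1=\{f_{b,\sigma}: b\in L\}$, a $K$-subspace of the space of alternating $K$-bilinear forms on $L$. Then there are $K$-subspaces $\mathcal V_1,\mathcal V_2,\mathcal E_1,\dots,\mathcal E_{\alpha-1}$ of $A^1$ with $$A^1=\mathcal V_1\oplus\mathcal V_2\oplus\mathcal E_1\oplus\cdots\oplus\mathcal E_{\alpha-1},$$ such that (i) for $1\le i\le\alpha-1$, $\dim_K\mathcal E_i=n/2^i$ and every nonzero form in $\mathcal E_i$ has rank $n$; (ii) for $j=1,2$, $\dim_K\mathcal V_j=k$ and every nonzero form in $\mathcal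 V_j$ has rank $n-2$. -/

import Mathlib

namespace SkewForms

/-- The skew-form `f_{b,σ}(x, y) = Tr_{L/K} (b (x σ(y) - σ(x) y))` on `L`. For `L/K` Galois,
`Algebra.trace K L a` is the sum of the conjugates `τ a`, `τ ∈ Gal(L/K)`. -/
noncomputable def skewForm {K L : Type*} [Field K] [Field L] [Algebra K L]
    (σ : L ≃ₐ[K] L) (b : L) : LinearMap.BilinForm K L :=
  LinearMap.mk₂ K (fun x y => Algebra.trace K L (b * (x * σ y - σ x * y)))
    (fun x x' y => by rw [← map_add]; congr 1; rw [map_add]; ring)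
    (fun c x y => by
      rw [← map_smul]; congr 1; rw [map_smul]; simp only [Algebra.smul_def]; ring)
    (fun x y y' => by rw [← map_add]; congr 1; rw [map_add]; ring)
    (fun c x y => by
      rw [← map_smul]; congr 1; rw [map_smul]; simp only [Algebra.smul_def]; ring)

theorem skewForm_apply {K L : Type*} [Field K] [Field L] [Algebra K L]
    (σ : L ≃ₐ[K] L) (b x y : L) :
    skewForm σ b x y = Algebra.trace K L (b * (x * σ y - σ x * y)) := rfl

theorem skewForm_isAlt {K L : Type*} [Field K] [Field L] [Algebra K L]
    (σ : L ≃ₐ[K] L) (b : L) : (skewForm σ b).IsAlt := by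
  intro x
  rw [skewForm_apply, mul_comm x, sub_self, mul_zero, map_zero]

/-- The subspace `A^σ = {f_{b,σ} : b ∈ L}` of the space of skew-forms on `L`. -/
noncomputable def skewSpace {K L : Type*} [Field K] [Field L] [Algebra K L]
    (σ : L ≃ₐ[K] L) : Submodule K (LinearMap.BilinForm K L) where
  carrier := Set.range (skewForm σ)
  add_mem' := by
    rintro _ _ ⟨b, rfl⟩ ⟨c, rfl⟩
    refine ⟨b + c, ?_⟩
    ext x y
    simp only [LinearMap.add_apply, skewForm_apply]
    rw [← map_add, add_mul]
  zero_mem' := by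
    refine ⟨0, ?_⟩
    ext x y
    simp [skewForm_apply]
  smul_mem' := by
    rintro c _ ⟨b, rfl⟩
    refine ⟨c • b, ?_⟩
    ext x y
    simp only [LinearMap.smul_apply, skewForm_apply]
    rw [← map_smul, smul_mul_assoc]

/-- The rank of a bilinear form: the dimension of the image of `x ↦ B(x, ·)`. -/
noncomputable def formRank {K V : Type*} [Field K] [AddCommGroup V] [Module K V]
    (B : LinearMap.BilinForm K V) : ℕ :=
  Module.finrank K (LinearMap.range B)

/-- An `r`-subspace: a subspace of skew-forms, all of whose nonzero members have rank `r`. -/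
def IsRankSubspace {K V : Type*} [Field K] [AddCommGroup V] [Module K V]
    (r : ℕ) (W : Submodule K (LinearMap.BilinForm K V)) : Prop :=
  (∀ B ∈ W, B.IsAlt) ∧ ∀ B ∈ W, B ≠ 0 → formRank B = r

/-- The extension `L/ℚ_p` is unramified: the ring of integers of `L` (the integral closure
of `ℤ_p` in `L`) is unramified over `ℤ_p`. -/
def IsUnramifiedExtension (p : ℕ) [Fact p.Prime] (L : Type*) [Field L] [Algebra ℚ_[p] L] :
    Prop :=
  letI : Algebra ℤ_[p] L := Algebra.compHom L (algebraMap ℤ_[p] ℚ_[p])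
  Algebra.FormallyUnramified ℤ_[p] (integralClosure ℤ_[p] L)

end SkewForms

namespace SkewForms

open Module Finset

/-! Since the trace is `σ`-invariant and nondegenerate, the kernel of `f_{b,σ}` is the solution set
of `σ(b) σ²(x) = b x` (`mem_ker_skewForm`). For `b ≠ 0`, quotients of solutions are fixed by `σ²`,
so the kernel is zero or a line over the quadratic fixed field of `σ²`: the rank is `n` or `n - 2`.

Repeatedly splitting fixed spaces of `σ^(2d)` into `±1`-eigenspaces of `σ^d` decomposes `L` into the
`-1`-eigenspaces of `σ^(n/2^i)`, `1 ≤ i ≤ α - 1`, and the two eigenspaces of `σ^k`. As `σ² ≠ 1`, `b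
↦ f_{b,σ}` is injective and carries this to the forms. On the eigenspaces of `σ^k`, oddness of `k`
gives an explicit solution (`exists_mul_apply_eq`). On the others, a nonzero solution would produce
a `2^i`-th root of unity `u` with `u σ(u) = -1` (`exists_rootOfUnity_mul_apply_eq_neg_one`).

Such `u` is excluded for `L = Frac W(𝔽_{p^n})`: since `2^a ∣ p + 1`, Frobenius inverts `u`, which
forces `u σ(u) = 1` (`mul_apply_eq_one_of_pow_eq_one`). -/

/-! ### Partial norms and the equation `σ(b) σ²(x) = b x`. -/

section OrbitProducts

variable {K L : Type*} [Field K] [Field L] [Algebra K L]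

/-- The partial norm `x τ(x) ⋯ τ^(m-1)(x)`. -/
noncomputable def orbitProd (τ : L ≃ₐ[K] L) (m : ℕ) (x : L) : L :=
  ∏ j ∈ range m, (τ ^ j) x

/-- Both sides are the product of `τ^j(x)` over `0 ≤ j ≤ m`. -/
theorem apply_orbitProd_mul (τ : L ≃ₐ[K] L) (m : ℕ) (x : L) :
    τ (orbitProd τ m x) * x = orbitProd τ m x * (τ ^ m) x := by
  have h : ∀ j, τ ((τ ^ j) x) = (τ ^ (j + 1)) x := fun j => by
    rw [pow_succ', AlgEquiv.mul_apply]
  simp only [orbitProd, map_prod, h]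
  rw [← prod_range_succ, prod_range_succ', pow_zero, AlgEquiv.one_apply]

theorem orbitProd_ne_zero (τ : L ≃ₐ[K] L) (m : ℕ) {x : L} (hx : x ≠ 0) :
    orbitProd τ m x ≠ 0 :=
  prod_ne_zero_iff.2 fun j _ => (map_ne_zero_iff _ (τ ^ j).injective).2 hx

theorem orbitProd_mul (τ : L ≃ₐ[K] L) (m : ℕ) (x y : L) :
    orbitProd τ m (x * y) = orbitProd τ m x * orbitProd τ m y := by
  simp [orbitProd, prod_mul_distrib]

theorem map_orbitProd {σ τ : L ≃ₐ[K] L} (h : Commute σ τ) (m : ℕ) (x : L) :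
    σ (orbitProd τ m x) = orbitProd τ m (σ x) := by
  simp only [orbitProd, map_prod]
  refine prod_congr rfl fun j _ => ?_
  rw [← AlgEquiv.mul_apply, ← AlgEquiv.mul_apply, (h.pow_right j).eq]

theorem pow_mul_pow_apply {ρ : L ≃ₐ[K] L} {u x : L} (hu : ρ u = u) (hx : u * ρ x = x) (m : ℕ) :
    u ^ m * (ρ ^ m) x = x := by
  induction m with
  | zero => simp
  | succ m ih =>
    have h := congrArg ρ ih
    rw [map_mul, map_pow, hu, ← AlgEquiv.mul_apply, ← pow_succ'] at h
    rw [pow_succ', mul_assoc, h, hx]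

theorem pow_apply_eq_self {τ : L ≃ₐ[K] L} {u : L} (hu : τ u = u) (e : ℕ) : (τ ^ e) u = u := by
  induction e with
  | zero => rfl
  | succ e ih => rw [pow_succ', AlgEquiv.mul_apply, ih, hu]

/-- If `σ^(2e)` negates `b` and the equation `σ(b) σ²(x) = b x` has a nonzero solution, then
there is a root of unity `u` with `u σ(u) = -1`. -/
theorem exists_rootOfUnity_mul_apply_eq_neg_one {σ : L ≃ₐ[K] L} {e m : ℕ} {b x : L}
    (hm : σ ^ (2 * e * m) = 1) (hb0 : b ≠ 0) (hx0 : x ≠ 0) (hb : (σ ^ (2 * e)) b = -b)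
    (h : σ b * (σ ^ 2) x = b * x) : ∃ u : L, u ^ m = 1 ∧ u * σ u = -1 := by
  set τ := σ ^ 2 with hτ
  have hcomm : Commute σ τ := (Commute.refl σ).pow_right 2
  have hQ0 := orbitProd_ne_zero τ e hb0
  have hX0 := orbitProd_ne_zero τ e hx0
  set Q := orbitProd τ e b with hQdef
  set X := orbitProd τ e x with hXdef
  have hQ : τ Q = -Q := by
    have := apply_orbitProd_mul τ e b
    rw [hτ, ← pow_mul, hb, ← hτ] at this
    exact mul_right_cancel₀ hb0 (by rw [this]; ring)
  have hX : τ X * x = X * (τ ^ e) x := apply_orbitProd_mul τ e x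
  have hQX : σ Q * τ X = Q * X := by
    rw [map_orbitProd hcomm, map_orbitProd (Commute.refl τ), ← orbitProd_mul, h, orbitProd_mul]
  have hτX0 : τ X ≠ 0 := (map_ne_zero_iff _ τ.injective).2 hX0
  have hσσ : σ (σ Q) = -Q := by rw [← hQ, hτ, pow_two, AlgEquiv.mul_apply]
  -- The root of unity is `u = σ(Q)/Q`. As `σ²(Q) = -Q`, it is fixed by `τ` and `u σ(u) = σ²(Q)/Q =
  -- -1`.
  have hu : τ (σ Q / Q) = σ Q / Q := by
    rw [map_div₀, hQ, ← AlgEquiv.mul_apply, ← hcomm.eq, AlgEquiv.mul_apply, hQ, map_neg, neg_div_neg_eq]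
  -- The equation for `x` also gives `u = X/τ(X)`. Iterating `u τ^e(x) = x` exactly `m` times yields
  -- `u^m = 1`, because `τ^(em) = 1`.
  have hux : σ Q / Q * (τ ^ e) x = x := by
    have h1 : σ Q / Q = X / τ X := by rw [div_eq_div_iff hQ0 hτX0, hQX, mul_comm]
    rw [h1, div_mul_eq_mul_div, ← hX, mul_div_cancel_left₀ _ hτX0]
  refine ⟨σ Q / Q, ?_, ?_⟩
  · have := pow_mul_pow_apply (pow_apply_eq_self hu e) hux m
    rw [hτ, ← pow_mul, ← pow_mul, ← mul_assoc, hm, AlgEquiv.one_apply] at this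
    exact mul_right_cancel₀ hx0 (by rw [this, one_mul])
  · have hσQ0 : σ Q ≠ 0 := (map_ne_zero_iff _ σ.injective).2 hQ0
    rw [map_div₀, hσσ]
    field_simp

/-- For odd `k`, an element `b` fixed by `σ^k` up to a sign `c` satisfies an equation
`σ(b) σ²(x) = b x` with `x ≠ 0`, provided the sign is of the form `σ²(w) / w`. -/
theorem exists_mul_apply_eq {σ : L ≃ₐ[K] L} {k : ℕ} (hk : Odd k) {b w c : L} (hb0 : b ≠ 0)
    (hw0 : w ≠ 0) (hcc : c * c = 1) (hb : (σ ^ k) b = c * b) (hw : (σ ^ 2) w = c * w) :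
    ∃ x : L, x ≠ 0 ∧ σ b * (σ ^ 2) x = b * x := by
  obtain ⟨r, rfl⟩ := hk
  have hσb : σ b ≠ 0 := (map_ne_zero_iff _ σ.injective).2 hb0
  -- With `k = 2r + 1`, the product `σ(b) σ³(b) ⋯ σ^(2r-1)(b)` solves the equation up to the factor
  -- `c`, since the shift by `σ²` ends at `σ^k(b) = c b`; `w` absorbs that sign.
  refine ⟨w * orbitProd (σ ^ 2) r (σ b), mul_ne_zero hw0 (orbitProd_ne_zero _ _ hσb), ?_⟩
  have h := apply_orbitProd_mul (σ ^ 2) r (σ b)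
  rw [← pow_mul, ← AlgEquiv.mul_apply (σ ^ (2 * r)), ← pow_succ, hb] at h
  rw [map_mul, hw]
  linear_combination (c * w) * h + (w * orbitProd (σ ^ 2) r (σ b) * b) * hcc

end OrbitProducts

/-! ### Eigenspaces of powers of `σ` and their dimensions. -/

section Eigenspaces

variable {K L : Type*} [Field K] [Field L] [Algebra K L]

/-- The `K`-subspace of elements of `L` multiplied by the scalar `c` under `σ^d`. -/
noncomputable def eigen (σ : L ≃ₐ[K] L) (d : ℕ) (c : K) : Submodule K L :=
  End.eigenspace (σ ^ d).toLinearMap c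

theorem mem_eigen {σ : L ≃ₐ[K] L} {d : ℕ} {c : K} {x : L} :
    x ∈ eigen σ d c ↔ (σ ^ d) x = c • x := End.mem_eigenspace_iff

theorem eigen_two_mul [NeZero (2 : K)] (σ : L ≃ₐ[K] L) (d : ℕ) :
    eigen σ (2 * d) 1 = eigen σ d 1 ⊔ eigen σ d (-1) := by
  have h2 : (2 : K) ≠ 0 := NeZero.ne 2
  have hdd : ∀ x, (σ ^ (2 * d)) x = (σ ^ d) ((σ ^ d) x) := fun x => by
    rw [two_mul, pow_add, AlgEquiv.mul_apply]
  apply le_antisymm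
  · intro x hx
    rw [mem_eigen, hdd, one_smul] at hx
    have : x = (2⁻¹ : K) • (x + (σ ^ d) x) + (2⁻¹ : K) • (x - (σ ^ d) x) := by
      rw [← smul_add, add_add_sub_cancel, ← two_smul K x, smul_smul, inv_mul_cancel₀ h2, one_smul]
    rw [this]
    refine Submodule.add_mem_sup (Submodule.smul_mem _ _ ?_) (Submodule.smul_mem _ _ ?_)
    · rw [mem_eigen, map_add, hx, one_smul, add_comm]
    · rw [mem_eigen, map_sub, hx, neg_one_smul, neg_sub]
  · refine sup_le (fun x hx => ?_) (fun x hx => ?_) <;> rw [mem_eigen] at hx ⊢ <;>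
      rw [hdd, hx, map_smul, hx, smul_smul] <;> norm_num

theorem finrank_eigen_one [FiniteDimensional K L] [IsGalois K L] {σ : L ≃ₐ[K] L}
    (hσ : Subgroup.zpowers σ = ⊤) {d : ℕ} (hd : d ∣ finrank K L) :
    finrank K (eigen σ d 1) = d := by
  have hn : 0 < finrank K L := finrank_pos
  have ho : orderOf σ = finrank K L := by
    rw [← Nat.card_zpowers, hσ, Subgroup.card_top, IsGalois.card_aut_eq_finrank]
  have hd0 : d ≠ 0 := by rintro rfl; rw [zero_dvd_iff] at hd; omega
  let F := IntermediateField.fixedField (Subgroup.zpowers (σ ^ d))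
  have hF : finrank F L = finrank K L / d := by
    rw [IntermediateField.finrank_fixedField_eq_card, Nat.card_zpowers,
      orderOf_pow_of_dvd hd0 (ho ▸ hd), ho]
  have hmul := finrank_mul_finrank K F L
  have hE : eigen σ d 1 = Subalgebra.toSubmodule F.toSubalgebra := by
    ext x
    rw [mem_eigen, one_smul, Subalgebra.mem_toSubmodule, IntermediateField.mem_toSubalgebra,
      IntermediateField.mem_fixedField_iff]
    refine ⟨fun hx f hf => ?_, fun h => h _ (Subgroup.mem_zpowers _)⟩
    have : Subgroup.zpowers (σ ^ d) ≤ MulAction.stabilizer (L ≃ₐ[K] L) x := by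
      rw [Subgroup.zpowers_le]; exact hx
    exact this hf
  rw [hE]
  change finrank K F = d
  obtain ⟨m, hm⟩ := hd
  rw [hF, hm, Nat.mul_div_cancel_left _ (Nat.pos_of_ne_zero hd0)] at hmul
  have hm0 : 0 < m := by
    rcases Nat.eq_zero_or_pos m with rfl | h
    · omega
    · exact h
  exact Nat.eq_of_mul_eq_mul_right hm0 hmul

theorem finrank_eigen_neg_one [NeZero (2 : K)] [FiniteDimensional K L] [IsGalois K L]
    {σ : L ≃ₐ[K] L} (hσ : Subgroup.zpowers σ = ⊤) {d : ℕ} (hd : 2 * d ∣ finrank K L) :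
    finrank K (eigen σ d (-1)) = d := by
  have h2 : (2 : K) ≠ 0 := NeZero.ne 2
  have h := Submodule.finrank_sup_add_finrank_inf_eq (eigen σ d 1) (eigen σ d (-1))
  have hinf : eigen σ d 1 ⊓ eigen σ d (-1) = ⊥ := by
    rw [eq_bot_iff]
    rintro x ⟨h1, h2'⟩
    rw [SetLike.mem_coe, mem_eigen] at h1 h2'
    rw [h1, ← sub_eq_zero, ← sub_smul, sub_neg_eq_add, one_add_one_eq_two] at h2'
    exact (smul_eq_zero.1 h2').resolve_left h2
  rw [← eigen_two_mul, hinf, finrank_bot, finrank_eigen_one hσ hd,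
    finrank_eigen_one hσ ((dvd_mul_left d 2).trans hd)] at h
  omega

/-- Iterates `eigen_two_mul`, halving the exponent `m` times and setting aside a `-1`-eigenspace
each time. -/
theorem eigen_le_of_forall [NeZero (2 : K)] {σ : L ≃ₐ[K] L} {n : ℕ} {W : Submodule K L} :
    ∀ m : ℕ, 2 ^ m ∣ n → (∀ i < m, eigen σ (n / 2 ^ (i + 1)) (-1) ≤ W) →
      eigen σ (n / 2 ^ m) 1 ≤ W → eigen σ n 1 ≤ W := by
  intro m
  induction m with
  | zero => intro _ _ h; simpa using h
  | succ m ih =>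
    intro hdvd hW hm
    refine ih ((pow_dvd_pow 2 m.le_succ).trans hdvd) (fun i hi => hW i (by omega)) ?_
    obtain ⟨r, rfl⟩ := hdvd
    have h1 : 2 ^ (m + 1) * r / 2 ^ m = 2 * r := by
      rw [pow_succ, mul_assoc, Nat.mul_div_cancel_left _ (by positivity)]
    have h2 : 2 ^ (m + 1) * r / 2 ^ (m + 1) = r := Nat.mul_div_cancel_left _ (by positivity)
    have h3 := hW m (by omega)
    rw [h2] at hm h3
    rw [h1, eigen_two_mul]
    exact sup_le hm h3

end Eigenspaces

/-- A finite family of subspaces which spans and whose dimensions add up is independent. -/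
theorem iSupIndep_of_iSup_eq_top_of_sum_finrank {K V ι : Type*} [Field K] [AddCommGroup V]
    [Module K V] [FiniteDimensional K V] [Fintype ι] (p : ι → Submodule K V) (htop : iSup p = ⊤)
    (hsum : ∑ i, finrank K (p i) = finrank K V) : iSupIndep p := by
  classical
  rw [iSupIndep_iff_dfinsupp_lsum_injective]
  have hs : Function.Surjective (DFinsupp.lsum ℕ fun i => (p i).subtype) := by
    rw [← LinearMap.range_eq_top, ← Submodule.iSup_eq_range_dfinsupp_lsum, htop]
  have hf : finrank K (Π₀ i, p i) = finrank K V := by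
    rw [← hsum]
    exact Module.finrank_directSum K fun i => p i
  have : FiniteDimensional K (Π₀ i, p i) :=
    Module.Finite.equiv (DFinsupp.linearEquivFunOnFintype (R := K) (M := fun i => p i)).symm
  exact (LinearMap.injective_iff_surjective_of_finrank_eq_finrank hf).2 hs

/-! ### Kernels and ranks of the forms. -/

section Rank

variable {K L : Type*} [Field K] [Field L] [Algebra K L] [FiniteDimensional K L] [IsGalois K L]

theorem mem_ker_skewForm {σ : L ≃ₐ[K] L} {b x : L} :
    x ∈ LinearMap.ker (skewForm σ b) ↔ σ b * (σ ^ 2) x = b * x := by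
  have key : ∀ y, skewForm σ b x y = Algebra.trace K L ((b * x - σ b * (σ ^ 2) x) * σ y) := by
    intro y
    have h := Algebra.trace_eq_of_algEquiv σ (b * (σ x * y))
    rw [map_mul σ, map_mul σ, ← AlgEquiv.mul_apply σ σ x, ← pow_two] at h
    rw [skewForm_apply, mul_sub, map_sub, ← h, ← map_sub]
    congr 1; ring
  rw [LinearMap.mem_ker]
  constructor
  · intro h
    have h0 : ∀ z, Algebra.traceForm K L (b * x - σ b * (σ ^ 2) x) z = 0 := by
      intro z
      have := key (σ.symm z)
      rw [h, AlgEquiv.apply_symm_apply] at this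
      rw [Algebra.traceForm_apply, ← this]; rfl
    exact (sub_eq_zero.1 ((traceForm_nondegenerate K L).1 _ h0)).symm
  · intro h
    ext y
    rw [key, h, sub_self, zero_mul, map_zero]; rfl

theorem formRank_skewForm_of_forall {σ : L ≃ₐ[K] L} {b : L}
    (h : ∀ x : L, σ b * (σ ^ 2) x = b * x → x = 0) :
    formRank (skewForm σ b) = finrank K L := by
  have hk : LinearMap.ker (skewForm σ b) = ⊥ :=
    (Submodule.eq_bot_iff _).2 fun x hx => h x (mem_ker_skewForm.1 hx)
  have := LinearMap.finrank_range_add_finrank_ker (skewForm σ b)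
  rwa [hk, finrank_bot, add_zero] at this

theorem formRank_skewForm_of_exists {σ : L ≃ₐ[K] L} (hσ : Subgroup.zpowers σ = ⊤)
    (h2 : 2 ∣ finrank K L) {b x : L} (hb : b ≠ 0) (hx0 : x ≠ 0)
    (hx : σ b * (σ ^ 2) x = b * x) :
    formRank (skewForm σ b) = finrank K L - 2 := by
  have hk : LinearMap.ker (skewForm σ b) = (eigen σ 2 1).map (LinearMap.mulLeft K x) := by
    have hσx : (σ ^ 2) x ≠ 0 := (map_ne_zero_iff _ (σ ^ 2).injective).2 hx0
    have hσb : σ b ≠ 0 := (map_ne_zero_iff _ σ.injective).2 hb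
    ext y
    rw [mem_ker_skewForm, Submodule.mem_map]
    constructor
    · intro hy
      refine ⟨y / x, ?_, by rw [LinearMap.mulLeft_apply, mul_div_cancel₀ _ hx0]⟩
      rw [mem_eigen, one_smul, map_div₀, div_eq_div_iff hσx hx0]
      refine mul_left_cancel₀ (mul_ne_zero hσb hb) ?_
      linear_combination (b * x) * hy - (b * y) * hx
    · rintro ⟨z, hz, rfl⟩
      rw [mem_eigen, one_smul] at hz
      rw [LinearMap.mulLeft_apply, map_mul, hz]
      linear_combination z * hx
  have hf : finrank K (LinearMap.ker (skewForm σ b)) = 2 := by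
    rw [hk, LinearEquiv.finrank_eq (Submodule.equivMapOfInjective (LinearMap.mulLeft K x)
      (mul_right_injective₀ hx0) _).symm, finrank_eigen_one hσ h2]
  have := LinearMap.finrank_range_add_finrank_ker (skewForm σ b)
  rw [hf] at this
  exact Nat.eq_sub_of_add_eq this

end Rank

/-- The forms `f_{b,σ}` as a linear function of `b`. -/
noncomputable def skewFormHom {K L : Type*} [Field K] [Field L] [Algebra K L] (σ : L ≃ₐ[K] L) :
    L →ₗ[K] LinearMap.BilinForm K L where
  toFun := skewForm σ
  map_add' b c := by
    ext x y
    simp only [LinearMap.add_apply, skewForm_apply]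
    rw [← map_add, add_mul]
  map_smul' c b := by
    ext x y
    simp only [LinearMap.smul_apply, skewForm_apply, RingHom.id_apply]
    rw [← map_smul, smul_mul_assoc]

theorem range_skewFormHom {K L : Type*} [Field K] [Field L] [Algebra K L] (σ : L ≃ₐ[K] L) :
    LinearMap.range (skewFormHom σ) = skewSpace σ := by
  ext B
  rfl

/-- If the form of some `b ≠ 0` vanished, the kernel equation would hold for all `x`; `x = 1` gives
`σ(b) = b`, and then `σ² = 1`. -/
theorem skewFormHom_injective {K L : Type*} [Field K] [Field L] [Algebra K L]
    [FiniteDimensional K L] [IsGalois K L] {σ : L ≃ₐ[K] L} (hσ : σ ^ 2 ≠ 1) :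
    Function.Injective (skewFormHom σ) := by
  rw [injective_iff_map_eq_zero]
  intro b hb
  by_contra hb0
  have hker : ∀ x, σ b * (σ ^ 2) x = b * x := fun x => by
    rw [← mem_ker_skewForm]
    change skewForm σ b = 0 at hb
    rw [hb]; simp
  have h1 : σ b = b := by simpa using hker 1
  refine hσ (AlgEquiv.ext fun x => ?_)
  have := hker x
  rw [h1] at this
  exact mul_left_cancel₀ hb0 this

/-- The decomposition of the space of forms `f_{b,σ}`, for a cyclic extension in which
`u σ(u) = 1` for the roots of unity `u` of order dividing `2^a`. -/
theorem exists_decomposition {K L : Type*} [Field K] [NeZero (2 : K)] [Field L] [Algebra K L]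
    [FiniteDimensional K L] [IsGalois K L] {n α k a : ℕ} (hk : Odd k) (hn : n = 2 ^ α * k)
    (hα : 2 ≤ α) (hαa : α ≤ a + 1) (hfin : finrank K L = n) (σ : L ≃ₐ[K] L)
    (hσ : Subgroup.zpowers σ = ⊤) (hu : ∀ u : L, u ^ 2 ^ a = 1 → u * σ u = 1) :
    ∃ (V : Fin 2 → Submodule K (LinearMap.BilinForm K L))
      (E : Fin (α - 1) → Submodule K (LinearMap.BilinForm K L)),
      iSupIndep (Sum.elim V E) ∧ (⨆ t, Sum.elim V E t) = skewSpace σ ∧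
      (∀ i : Fin (α - 1), IsRankSubspace n (E i) ∧ finrank K (E i) = n / 2 ^ ((i : ℕ) + 1)) ∧
      (∀ j : Fin 2, IsRankSubspace (n - 2) (V j) ∧ finrank K (V j) = k) := by
  have hk0 : 0 < k := hk.pos
  obtain ⟨β, rfl⟩ := Nat.exists_eq_add_of_le' hα
  have hn4 : n = 4 * (2 ^ β * k) := by rw [hn, pow_add]; ring
  have hr : 0 < 2 ^ β * k := by positivity
  have ho : orderOf σ = n := by
    rw [← Nat.card_zpowers, hσ, Subgroup.card_top, IsGalois.card_aut_eq_finrank, hfin]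
  have hσn : σ ^ n = 1 := ho ▸ pow_orderOf_eq_one σ
  have hσ2 : σ ^ 2 ≠ 1 := fun h => by
    have := Nat.le_of_dvd (by norm_num) (orderOf_dvd_of_pow_eq_one h)
    omega
  have hinj := skewFormHom_injective hσ2
  have hfm : ∀ p : Submodule K L, finrank K (p.map (skewFormHom σ)) = finrank K p := fun p =>
    (LinearEquiv.finrank_eq (Submodule.equivMapOfInjective _ hinj p)).symm
  have hdiv : ∀ i ≤ β + 2, n / 2 ^ i = 2 ^ (β + 2 - i) * k := fun i hi => by
    rw [hn, ← Nat.sub_add_cancel hi, pow_add, Nat.add_sub_cancel, mul_right_comm,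
      Nat.mul_div_cancel _ (by positivity)]
  -- The subspaces of `L` from which the subspaces of forms arise.
  let V : Fin 2 → Submodule K L := fun j => eigen σ k ((-1) ^ (j : ℕ))
  let E : Fin (β + 2 - 1) → Submodule K L := fun i => eigen σ (n / 2 ^ ((i : ℕ) + 1)) (-1)
  have hV0 : V 0 = eigen σ k 1 := congrArg (eigen σ k) (pow_zero _)
  have hV1 : V 1 = eigen σ k (-1) := congrArg (eigen σ k) (pow_one _)
  have hVfin : ∀ j, finrank K (V j) = k := by
    have hd : 2 * k ∣ finrank K L := by
      rw [hfin, hn4]; exact ⟨2 * 2 ^ β, by ring⟩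
    intro j
    fin_cases j
    · exact hV0 ▸ finrank_eigen_one hσ ((dvd_mul_left k 2).trans hd)
    · exact hV1 ▸ finrank_eigen_neg_one hσ hd
  have hEfin : ∀ i, finrank K (E i) = n / 2 ^ ((i : ℕ) + 1) := by
    intro i
    refine finrank_eigen_neg_one hσ ?_
    have hi := i.2
    rw [hdiv _ (by omega), hfin, hn, ← mul_assoc, ← pow_succ']
    exact mul_dvd_mul_right (pow_dvd_pow 2 (by omega)) k
  have htop : iSup (Sum.elim V E) = ⊤ := by
    rw [eq_top_iff]
    have h1 : (⊤ : Submodule K L) = eigen σ n 1 := by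
      ext x; simp [mem_eigen, hσn]
    rw [h1]
    refine eigen_le_of_forall (β + 1) (hn ▸ ⟨2 * k, by ring⟩) (fun i hi => ?_) ?_
    · exact le_iSup (Sum.elim V E) (Sum.inr ⟨i, by omega⟩)
    · rw [hdiv _ (by omega), show β + 2 - (β + 1) = 1 by omega, pow_one, eigen_two_mul]
      refine sup_le ?_ ?_
      · exact hV0 ▸ le_iSup (Sum.elim V E) (Sum.inl 0)
      · exact hV1 ▸ le_iSup (Sum.elim V E) (Sum.inl 1)
  have hsum : ∑ t, finrank K (Sum.elim V E t : Submodule K L) = finrank K L := by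
    have hsplit : ∑ t, finrank K (Sum.elim V E t : Submodule K L) =
        (∑ _j : Fin 2, k) + ∑ i : Fin (β + 1), n / 2 ^ ((i : ℕ) + 1) := by
      rw [Fintype.sum_sum_type]
      exact congrArg₂ _ (sum_congr rfl fun j _ => hVfin j) (sum_congr rfl fun i _ => hEfin i)
    rw [hsplit]
    -- At `m = α - 1` the remainder `n / 2^m` is `2k`, the total dimension of the two `V j`.
    have h : ∀ m ≤ β + 1, ∑ i ∈ range m, n / 2 ^ (i + 1) + n / 2 ^ m = n := by
      intro m
      induction m with
      | zero => simp
      | succ m ih =>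
        intro hm
        have hih := ih (by omega)
        rw [hdiv m (by omega), show β + 2 - m = β + 2 - (m + 1) + 1 by omega, pow_succ] at hih
        rw [sum_range_succ, hdiv (m + 1) (by omega)]
        linarith
    have h' := h (β + 1) le_rfl
    rw [hdiv _ (by omega), show β + 2 - (β + 1) = 1 by omega] at h'
    rw [Fin.sum_univ_eq_sum_range (fun i => n / 2 ^ (i + 1)),
      Finset.sum_const, Finset.card_univ, Fintype.card_fin, hfin, smul_eq_mul]
    omega
  have hind := iSupIndep_of_iSup_eq_top_of_sum_finrank (Sum.elim V E) htop hsum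
  have helim : ∀ t, Sum.elim (fun j => (V j).map (skewFormHom σ))
      (fun i => (E i).map (skewFormHom σ)) t = (Sum.elim V E t).map (skewFormHom σ) := by
    rintro (j | i) <;> rfl
  refine ⟨fun j => (V j).map (skewFormHom σ), fun i => (E i).map (skewFormHom σ), ?_, ?_,
    fun i => ⟨⟨?_, ?_⟩, (hfm _).trans (hEfin i)⟩, fun j => ⟨⟨?_, ?_⟩, (hfm _).trans (hVfin j)⟩⟩
  · rw [funext helim]
    exact (skewFormHom σ).iSupIndep_map hinj hind
  · rw [funext helim, ← Submodule.map_iSup, ← range_skewFormHom, ← Submodule.map_top]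
    exact congrArg _ htop
  · rintro _ ⟨b, -, rfl⟩
    exact skewForm_isAlt σ b
  · rintro _ ⟨b, hb, rfl⟩ hne
    have hb0 : b ≠ 0 := by rintro rfl; exact hne (map_zero _)
    refine (formRank_skewForm_of_forall fun x hx => ?_).trans hfin
    by_contra hx0
    have hi := i.2
    have hd : n / 2 ^ ((i : ℕ) + 1) = 2 * (2 ^ (β - i) * k) := by
      rw [hdiv _ (by omega), show β + 2 - (i + 1) = β - i + 1 by omega, pow_succ]; ring
    rw [SetLike.mem_coe, mem_eigen, hd, neg_one_smul] at hb
    obtain ⟨u, hu1, hu2⟩ := exists_rootOfUnity_mul_apply_eq_neg_one (m := 2 ^ ((i : ℕ) + 1))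
      (by rw [← hd, Nat.div_mul_cancel, hσn]
          exact hn ▸ (pow_dvd_pow 2 (by omega)).mul_right k) hb0 hx0 hb hx
    -- The bound `α ≤ a + 1` enters here: the order of `u` divides `2^a`, so `u σ(u)` is both `1`
    -- and `-1`.
    obtain ⟨c, hc⟩ := pow_dvd_pow 2 (show (i : ℕ) + 1 ≤ a by omega)
    rw [hu u (by rw [hc, pow_mul, hu1, one_pow])] at hu2
    have h2 : (2 : K) ≠ 0 := NeZero.ne 2
    apply h2
    apply (algebraMap K L).injective
    rw [map_ofNat, map_zero]
    linear_combination hu2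
  · rintro _ ⟨b, -, rfl⟩
    exact skewForm_isAlt σ b
  · rintro _ ⟨b, hb, rfl⟩ hne
    have hb0 : b ≠ 0 := by rintro rfl; exact hne (map_zero _)
    rw [← hfin]
    -- an element negated by `σ²`
    obtain ⟨w, hw0, hw⟩ : ∃ w : L, w ≠ 0 ∧ (σ ^ 2) w = -w := by
      have hpos : 0 < finrank K (eigen σ (2 * k) (-1)) := by
        rw [finrank_eigen_neg_one hσ (by rw [hfin, hn4]; exact ⟨2 ^ β, by ring⟩)]
        omega
      have := Module.finrank_pos_iff.1 hpos
      obtain ⟨⟨z, hz⟩, hz0⟩ := exists_ne (0 : eigen σ (2 * k) (-1))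
      rw [mem_eigen, neg_one_smul] at hz
      have hz0 : z ≠ 0 := fun h => hz0 (Subtype.ext h)
      -- Applying `σ²` multiplies this partial norm by `σ^(2k)(z)/z = -1`. Such `z` exists because
      -- `4k ∣ n`.
      refine ⟨orbitProd (σ ^ 2) k z, orbitProd_ne_zero _ _ hz0, mul_right_cancel₀ hz0 ?_⟩
      rw [apply_orbitProd_mul, ← pow_mul, hz]
      ring
    rw [SetLike.mem_coe] at hb
    obtain ⟨x, hx0, hx⟩ : ∃ x : L, x ≠ 0 ∧ σ b * (σ ^ 2) x = b * x := by
      fin_cases j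
      · refine exists_mul_apply_eq (c := 1) hk hb0 one_ne_zero (one_mul 1) ?_ (by simp)
        simpa [V, mem_eigen] using hb
      · refine exists_mul_apply_eq (c := -1) hk hb0 hw0 (by ring) ?_ (by rw [hw]; ring)
        simpa [V, mem_eigen] using hb
    exact formRank_skewForm_of_exists hσ (by rw [hfin, hn4]; exact ⟨2 * (2 ^ β * k), by ring⟩)
      hb0 hx0 hx

/-! ### The unramified extension `Frac W(k)` of `ℚ_p`. -/

section WittVectors

open WittVector

/-- An element of `W(k)` of finite order prime to `p` which reduces to `1` is `1`. -/
theorem eq_one_of_pow_eq_one {p : ℕ} [Fact p.Prime] {k : Type*} [Field k] [CharP k p]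
    {v : WittVector p k} {m : ℕ} (hm : (m : k) ≠ 0) (hv : v ^ m = 1) (h1 : v.coeff 0 = 1) : v = 1 := by
  -- The cofactor `1 + v + ⋯ + v^(m-1)` of `v - 1` reduces to `m ≠ 0` in the residue field.
  have h := mul_geom_sum v m
  rw [hv, sub_self, mul_eq_zero] at h
  refine sub_eq_zero.1 (h.resolve_right fun h0 => hm ?_)
  have h2 := congrArg (WittVector.constantCoeff (p := p) (R := k)) h0
  have h3 : WittVector.constantCoeff v = 1 := h1
  simpa [map_sum, map_pow, h3] using h2

variable (p : ℕ) [Fact p.Prime] (k : Type*) [Field k] [Algebra (ZMod p) k]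

/-- The embedding of `ℤ_p = W(𝔽_p)` into `W(k)`. -/
noncomputable def padicIntToWitt : ℤ_[p] →+* WittVector p k :=
  (WittVector.map (algebraMap (ZMod p) k)).comp (WittVector.equiv p).symm.toRingHom

noncomputable instance padicIntAlgebra : Algebra ℤ_[p] (WittVector p k) :=
  (padicIntToWitt p k).toAlgebra

theorem padicIntToWitt_injective : Function.Injective (algebraMap ℤ_[p] (WittVector p k)) :=
  (WittVector.map_injective _ (algebraMap (ZMod p) k).injective).comp
    (WittVector.equiv p).symm.injective

instance : FaithfulSMul ℤ_[p] (WittVector p k) :=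
  (faithfulSMul_iff_algebraMap_injective _ _).2 (padicIntToWitt_injective p k)

variable [CharP k p]

theorem mem_range_algebraMap_of_frobenius_eq {w : WittVector p k} (hw : frobenius w = w) :
    ∃ z, algebraMap ℤ_[p] (WittVector p k) z = w := by
  have h : ∀ i, ∃ c, algebraMap (ZMod p) k c = w.coeff i := fun i => by
    have h1 : w.coeff i ^ p = w.coeff i := by rw [← coeff_frobenius_charP, hw]
    have h2 : w.coeff i ∈ (⊥ : Subfield k) := (Subfield.mem_bot_iff_pow_eq_self k p).2 h1
    have h3 : (⊥ : Subfield k) ≤ (algebraMap (ZMod p) k).fieldRange := bot_le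
    exact h3 h2
  choose c hc using h
  refine ⟨WittVector.equiv p (WittVector.mk p c), ?_⟩
  change WittVector.map _ ((WittVector.equiv p).symm (WittVector.equiv p _)) = w
  rw [RingEquiv.symm_apply_apply]
  ext i
  rw [map_coeff]
  exact hc i

theorem frobenius_algebraMap (z : ℤ_[p]) :
    frobenius (algebraMap ℤ_[p] (WittVector p k) z) = algebraMap ℤ_[p] (WittVector p k) z := by
  ext i
  rw [coeff_frobenius_charP]
  change (WittVector.map _ ((WittVector.equiv p).symm z)).coeff i ^ p =
    (WittVector.map _ ((WittVector.equiv p).symm z)).coeff i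
  rw [map_coeff, ← map_pow, ZMod.pow_card]

variable [Finite k]

/-- The Frobenius of `W(k)` as an automorphism over `ℤ_p`. -/
noncomputable def frobAlgEquiv : WittVector p k ≃ₐ[ℤ_[p]] WittVector p k :=
  AlgEquiv.ofRingEquiv (f := WittVector.frobeniusEquiv p k) (frobenius_algebraMap p k)

variable {k} in
theorem frobAlgEquiv_apply (w : WittVector p k) : frobAlgEquiv p k w = frobenius w := rfl

theorem coeff_frobAlgEquiv_pow (m : ℕ) (w : WittVector p k) (i : ℕ) :
    ((frobAlgEquiv p k ^ m) w).coeff i = w.coeff i ^ p ^ m := by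
  induction m with
  | zero => simp
  | succ m ih =>
    rw [pow_succ', AlgEquiv.mul_apply, frobAlgEquiv_apply, coeff_frobenius_charP, ih, ← pow_mul,
      pow_succ]

/-- Frobenius raises every Witt coefficient to the `p`-th power, and Teichmüller lifts realise every
residue, so its order is that of Frobenius on `k`. -/
theorem orderOf_frobAlgEquiv : orderOf (frobAlgEquiv p k) = finrank (ZMod p) k := by
  rw [← FiniteField.orderOf_frobeniusAlgEquivOfAlgebraic (ZMod p) k, orderOf_eq_orderOf_iff]
  intro m
  have hf : ∀ c, (FiniteField.frobeniusAlgEquivOfAlgebraic (ZMod p) k ^ m) c = c ^ p ^ m := by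
    intro c
    rw [AlgEquiv.coe_pow, FiniteField.coe_frobeniusAlgEquivOfAlgebraic_iterate, ZMod.card]
  constructor
  · intro h
    ext c
    have := coeff_frobAlgEquiv_pow p k m (teichmuller p c) 0
    rw [h, AlgEquiv.one_apply, teichmuller_coeff_zero] at this
    rw [hf, ← this, AlgEquiv.one_apply]
  · intro h
    ext w i
    rw [coeff_frobAlgEquiv_pow, ← hf, h, AlgEquiv.one_apply, AlgEquiv.one_apply]

/-- The cyclic group generated by the Frobenius of `W(k)`. -/
noncomputable abbrev FrobGroup : Subgroup (WittVector p k ≃ₐ[ℤ_[p]] WittVector p k) :=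
  Subgroup.zpowers (frobAlgEquiv p k)

instance : Finite (FrobGroup p k) := by
  refine finite_zpowers.2 (orderOf_pos_iff.1 ?_)
  rw [orderOf_frobAlgEquiv]
  exact finrank_pos

theorem card_frobGroup : Nat.card (FrobGroup p k) = finrank (ZMod p) k := by
  rw [Nat.card_zpowers, orderOf_frobAlgEquiv]

instance : IsGaloisGroup (FrobGroup p k) ℤ_[p] (WittVector p k) where
  faithful := inferInstance
  commutes := inferInstance
  isInvariant := ⟨fun _ hw => mem_range_algebraMap_of_frobenius_eq p k
    (hw ⟨frobAlgEquiv p k, Subgroup.mem_zpowers _⟩)⟩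

instance : Algebra.IsIntegral ℤ_[p] (WittVector p k) :=
  Algebra.IsInvariant.isIntegral ℤ_[p] (WittVector p k) (FrobGroup p k)

/-- The fraction field of `W(k)` as an extension of `ℚ_p`. -/
noncomputable instance padicAlgebra : Algebra ℚ_[p] (FractionRing (WittVector p k)) :=
  (IsFractionRing.lift (A := ℤ_[p]) (K := ℚ_[p])
    (g := algebraMap ℤ_[p] (FractionRing (WittVector p k)))
    (FaithfulSMul.algebraMap_injective _ _)).toAlgebra

instance : IsScalarTower ℤ_[p] ℚ_[p] (FractionRing (WittVector p k)) :=
  IsScalarTower.of_algebraMap_eq fun z => (IsFractionRing.lift_algebraMap _ z).symm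

noncomputable instance : MulSemiringAction (FrobGroup p k) (FractionRing (WittVector p k)) :=
  IsFractionRing.mulSemiringAction (FrobGroup p k) (WittVector p k) (FractionRing (WittVector p k))

instance : SMulDistribClass (FrobGroup p k) (WittVector p k) (FractionRing (WittVector p k)) :=
  IsFractionRing.smulDistribClass (FrobGroup p k) (WittVector p k) (FractionRing (WittVector p k))

instance : IsGaloisGroup (FrobGroup p k) ℚ_[p] (FractionRing (WittVector p k)) :=
  IsGaloisGroup.to_isFractionRing (FrobGroup p k) ℤ_[p] (WittVector p k) ℚ_[p]
    (FractionRing (WittVector p k))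

theorem finrank_fractionRing_wittVector :
    finrank ℚ_[p] (FractionRing (WittVector p k)) = finrank (ZMod p) k := by
  rw [← IsGaloisGroup.card_eq_finrank (FrobGroup p k), card_frobGroup]

instance : FiniteDimensional ℚ_[p] (FractionRing (WittVector p k)) :=
  IsGaloisGroup.finiteDimensional (FrobGroup p k) _ _

instance : IsGalois ℚ_[p] (FractionRing (WittVector p k)) :=
  IsGaloisGroup.isGalois (FrobGroup p k) _ _

/-- The Frobenius group of `W(k)` is the Galois group of its fraction field over `ℚ_p`. -/
noncomputable def frobGroupEquiv :
    FrobGroup p k ≃* (FractionRing (WittVector p k) ≃ₐ[ℚ_[p]] FractionRing (WittVector p k)) :=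
  IsGaloisGroup.mulEquivAlgEquiv _ _ _

theorem frobGroupEquiv_algebraMap (g : FrobGroup p k) (w : WittVector p k) :
    frobGroupEquiv p k g (algebraMap _ (FractionRing (WittVector p k)) w) =
      algebraMap _ _ (g.1 w) := by
  rw [frobGroupEquiv, IsGaloisGroup.mulEquivAlgEquiv_apply_apply]
  exact (algebraMap.coe_smul' g w (FractionRing (WittVector p k))).symm

theorem isCyclic_fractionRing_wittVector :
    IsCyclic (FractionRing (WittVector p k) ≃ₐ[ℚ_[p]] FractionRing (WittVector p k)) :=
  isCyclic_of_surjective _ (frobGroupEquiv p k).surjective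

/-- If `σ` generates the Galois group, then `u σ(u) = 1` for the roots of unity `u` of order
dividing `p + 1`: the Frobenius inverts `u`, so `σ` either inverts `u` or fixes `u = u⁻¹`. -/
theorem mul_apply_eq_one_of_pow_eq_one
    {σ : FractionRing (WittVector p k) ≃ₐ[ℚ_[p]] FractionRing (WittVector p k)}
    (hσ : Subgroup.zpowers σ = ⊤) {m : ℕ} (hm : (m : k) ≠ 0) (hmp : m ∣ p + 1)
    {u : FractionRing (WittVector p k)} (hu : u ^ m = 1) : u * σ u = 1 := by
  have hm0 : 0 < m := Nat.pos_of_ne_zero (by rintro rfl; simp at hm)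
  have hu0 : u ≠ 0 := by rintro rfl; rw [zero_pow hm0.ne'] at hu; exact zero_ne_one hu
  obtain ⟨w, rfl⟩ : ∃ w, algebraMap (WittVector p k) (FractionRing (WittVector p k)) w = u :=
    IsIntegrallyClosed.algebraMap_eq_of_integral
      ⟨Polynomial.X ^ m - 1, Polynomial.monic_X_pow_sub_C 1 hm0.ne', by simp [hu]⟩
  set u := algebraMap (WittVector p k) (FractionRing (WittVector p k)) w
  have hw : w ^ m = 1 := by
    apply IsFractionRing.injective (WittVector p k) (FractionRing (WittVector p k))
    rw [map_pow, map_one, hu]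
  have hc : w.coeff 0 ^ m = 1 := by
    have := congrArg (WittVector.constantCoeff (p := p) (R := k)) hw
    rwa [map_pow, map_one] at this
  have hwφ : w * frobenius w = 1 := by
    apply eq_one_of_pow_eq_one hm
    · rw [mul_pow, ← map_pow, hw, map_one, mul_one]
    · have h1 : (w * frobenius w).coeff 0 = w.coeff 0 * (frobenius w).coeff 0 :=
        map_mul (WittVector.constantCoeff (p := p) (R := k)) _ _
      obtain ⟨c, hcm⟩ := hmp
      rw [h1, coeff_frobenius_charP, ← pow_succ', hcm, pow_mul, hc, one_pow]
  set Φ := frobGroupEquiv p k ⟨frobAlgEquiv p k, Subgroup.mem_zpowers _⟩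
  have hΦ : Φ u = u⁻¹ := by
    refine eq_inv_of_mul_eq_one_right ?_
    rw [frobGroupEquiv_algebraMap, ← map_mul]
    exact (congrArg _ hwφ).trans (map_one _)
  have hpow : ∀ j : ℕ, (Φ ^ j) u = u ∨ (Φ ^ j) u = u⁻¹ := by
    intro j
    induction j with
    | zero => exact Or.inl rfl
    | succ j ih =>
      rw [pow_succ', AlgEquiv.mul_apply]
      rcases ih with h | h
      · exact Or.inr (by rw [h, hΦ])
      · exact Or.inl (by rw [h, map_inv₀, hΦ, inv_inv])
  obtain ⟨j, hj⟩ : ∃ j : ℕ, Φ ^ j = σ := by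
    obtain ⟨⟨g, hg⟩, rfl⟩ := (frobGroupEquiv p k).surjective σ
    have hfin : IsOfFinOrder (frobAlgEquiv p k) := by
      rw [← orderOf_pos_iff, orderOf_frobAlgEquiv]; exact finrank_pos
    obtain ⟨j, rfl⟩ := hfin.mem_powers_iff_mem_zpowers.2 hg
    exact ⟨j, (map_pow (frobGroupEquiv p k) _ j).symm⟩
  rcases hpow j with h | h <;> rw [hj] at h
  · have hstab : Subgroup.zpowers σ ≤
        MulAction.stabilizer (FractionRing (WittVector p k) ≃ₐ[ℚ_[p]] _) u := by
      rw [Subgroup.zpowers_le]; exact h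
    have hΦu : Φ u = u := hstab (hσ ▸ Subgroup.mem_top Φ)
    rw [h]
    nth_rewrite 1 [← hΦu]
    rw [hΦ, inv_mul_cancel₀ hu0]
  · rw [h, mul_inv_cancel₀ hu0]

instance : IsIntegralClosure (WittVector p k) ℤ_[p] (FractionRing (WittVector p k)) :=
  IsIntegralClosure.of_isIntegrallyClosed (WittVector p k) ℤ_[p] (FractionRing (WittVector p k))

instance : Module.Finite ℤ_[p] (WittVector p k) :=
  IsIntegralClosure.finite ℤ_[p] ℚ_[p] (FractionRing (WittVector p k)) (WittVector p k)

/-- `W(k)` is unramified over `ℤ_p`: every element is a `p`-th power up to a multiple of `p`, so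
the module of differentials is divisible by `p`. -/
instance : Algebra.FormallyUnramified ℤ_[p] (WittVector p k) := by
  let D := KaehlerDifferential.D ℤ_[p] (WittVector p k)
  let I : Ideal (WittVector p k) := Ideal.span {(p : WittVector p k)}
  have hI : I ≤ (⊥ : Ideal (WittVector p k)).jacobson := by
    rw [IsLocalRing.jacobson_eq_maximalIdeal ⊥ bot_ne_top, Ideal.span_singleton_le_iff_mem,
      IsLocalRing.mem_maximalIdeal]
    exact (WittVector.irreducible p).not_isUnit
  have hpI : ∀ x : Ω[WittVector p k⁄ℤ_[p]], (p : WittVector p k) • x ∈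
      I • (⊤ : Submodule (WittVector p k) (Ω[WittVector p k⁄ℤ_[p]])) := fun x =>
    Submodule.smul_mem_smul (Ideal.mem_span_singleton_self _) trivial
  have hD : ∀ w, D w ∈ I • (⊤ : Submodule (WittVector p k) (Ω[WittVector p k⁄ℤ_[p]])) := by
    intro w
    obtain ⟨c, hc⟩ := surjective_frobenius k p (w.coeff 0)
    have hmem : w - teichmuller p c ^ p ∈ Ideal.span {(p : WittVector p k)} := by
      rw [mem_span_p_iff_coeff_zero_eq_zero]
      have h1 : (w - teichmuller p c ^ p).coeff 0 = w.coeff 0 - (teichmuller p c).coeff 0 ^ p :=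
        (map_sub (WittVector.constantCoeff (p := p) (R := k)) _ _).trans
          (congrArg _ (map_pow WittVector.constantCoeff _ _))
      rw [h1, teichmuller_coeff_zero, ← hc, frobenius_def, sub_self]
    obtain ⟨v, hv⟩ := Ideal.mem_span_singleton.1 hmem
    rw [← sub_add_cancel w (teichmuller p c ^ p), map_add, hv, Derivation.leibniz,
      Derivation.leibniz_pow, Derivation.map_natCast, smul_zero, add_zero,
      ← Nat.cast_smul_eq_nsmul (WittVector p k)]
    exact add_mem (hpI _) (hpI _)
  refine ⟨subsingleton_of_forall_eq 0 fun x => ?_⟩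
  -- Nakayama's lemma: the differentials are finitely generated and `p` lies in the maximal ideal.
  have hbot := Submodule.eq_bot_of_le_smul_of_le_jacobson_bot I
    (⊤ : Submodule (WittVector p k) (Ω[WittVector p k⁄ℤ_[p]])) Module.Finite.fg_top
    (by
      conv_lhs => rw [← KaehlerDifferential.span_range_derivation]
      rw [Submodule.span_le]
      rintro _ ⟨w, rfl⟩
      exact hD w) hI
  exact (Submodule.mem_bot _).1 (hbot ▸ Submodule.mem_top)

theorem isUnramifiedExtension_fractionRing_wittVector :
    IsUnramifiedExtension p (FractionRing (WittVector p k)) := by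
  have h : Algebra.FormallyUnramified ℤ_[p]
      (integralClosure ℤ_[p] (FractionRing (WittVector p k))) :=
    Algebra.FormallyUnramified.of_equiv
      (IsIntegralClosure.equiv ℤ_[p] (WittVector p k) (FractionRing (WittVector p k))
        (integralClosure ℤ_[p] (FractionRing (WittVector p k))))
  have halg : Algebra.compHom (FractionRing (WittVector p k)) (algebraMap ℤ_[p] ℚ_[p]) =
      (inferInstance : Algebra ℤ_[p] (FractionRing (WittVector p k))) :=
    Algebra.algebra_ext _ _ fun z =>
      (IsScalarTower.algebraMap_apply ℤ_[p] ℚ_[p] (FractionRing (WittVector p k)) z).symm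
  unfold IsUnramifiedExtension
  rw [halg]
  exact h

end WittVectors

end SkewForms

/-! ### The theorem, with residue field `𝔽_{p^n}`. -/

theorem theoremD (p : ℕ) [Fact p.Prime] (hp : ¬ IsSquare (-1 : ℚ_[p]))
    (a l : ℕ) (hl : Odd l) (hpa : p + 1 = 2 ^ a * l)
    (n α k : ℕ) (hk : Odd k) (hn : n = 2 ^ α * k) (hα : 2 ≤ α) (hαa : α ≤ a + 1) :
    ∃ (L : Type) (_ : Field L) (_ : Algebra ℚ_[p] L),
      Module.finrank ℚ_[p] L = n ∧
      IsGalois ℚ_[p] L ∧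
      IsCyclic (L ≃ₐ[ℚ_[p]] L) ∧
      SkewForms.IsUnramifiedExtension p L ∧
      ∀ σ : L ≃ₐ[ℚ_[p]] L, Subgroup.zpowers σ = ⊤ →
        ∃ (V : Fin 2 → Submodule ℚ_[p] (LinearMap.BilinForm ℚ_[p] L))
          (E : Fin (α - 1) → Submodule ℚ_[p] (LinearMap.BilinForm ℚ_[p] L)),
          iSupIndep (Sum.elim V E) ∧
          (⨆ t, Sum.elim V E t) = SkewForms.skewSpace σ ∧
          (∀ i : Fin (α - 1), SkewForms.IsRankSubspace n (E i) ∧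
            Module.finrank ℚ_[p] (E i) = n / 2 ^ ((i : ℕ) + 1)) ∧
          (∀ j : Fin 2, SkewForms.IsRankSubspace (n - 2) (V j) ∧
            Module.finrank ℚ_[p] (V j) = k) := by
  have hn0 : n ≠ 0 := by
    rw [hn]; exact mul_ne_zero (by positivity) hk.pos.ne'
  have hfin : Module.finrank ℚ_[p] (FractionRing (WittVector p (GaloisField p n))) = n := by
    rw [SkewForms.finrank_fractionRing_wittVector, GaloisField.finrank p hn0]
  -- As `2^a ∣ p + 1`, it is prime to `p`, so roots of unity of this order are determined by their
  -- residues.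
  have h2 : ((2 ^ a : ℕ) : GaloisField p n) ≠ 0 := by
    intro h
    have hpd : p ∣ 2 ^ a := (CharP.cast_eq_zero_iff (GaloisField p n) p _).1 h
    have hp1 : p ∣ p + 1 := hpa ▸ hpd.mul_right l
    exact (Fact.out : p.Prime).one_lt.ne' (Nat.dvd_one.1 ((Nat.dvd_add_right dvd_rfl).1 hp1))
  exact ⟨FractionRing (WittVector p (GaloisField p n)), inferInstance, inferInstance, hfin,
    inferInstance, SkewForms.isCyclic_fractionRing_wittVector p _,
    SkewForms.isUnramifiedExtension_fractionRing_wittVector p _, fun σ hσ =>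
      SkewForms.exists_decomposition hk hn hα hαa hfin σ hσ fun _ hu =>
        SkewForms.mul_apply_eq_one_of_pow_eq_one p _ hσ h2 (hpa ▸ dvd_mul_right _ l) hu⟩
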